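/- Let $R$ be an associative ring with identity. A right $R$-module is called \emph{proper cyclic} if it is cyclic (generated by one element) and not isomorphic to $R_R$. The ring $R$ is called a \emph{right PCI ring} if every proper cyclic right $R$-module is injective, and a \emph{proper right PCI ring} if, in addition, $R$ is not right self-injective (that is, $R_R$ is not an injective right $R$-module). \textbf{Proposition (Faith).} Every proper right PCI ring is a domain; that is, $R \neq 0$, and $ab = 0$ implies $a = 0$ or $b = 0$ for all $a, b \in R$. -/

import Mathlib

universe u

/-- A cyclic right `R`-module (right `R`-modules are modules over `Rᵐᵒᵖ`): one that is
generated by a single element. -/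
def IsCyclicRightModule (R : Type u) [Ring R] (M : Type u) [AddCommGroup M] [Module Rᵐᵒᵖ M] :
    Prop :=
  ∃ m : M, Submodule.span Rᵐᵒᵖ {m} = ⊤

/-- A proper cyclic right `R`-module: one that is cyclic and not isomorphic to `R_R`. -/
def IsProperCyclicRightModule (R : Type u) [Ring R] (M : Type u) [AddCommGroup M]
    [Module Rᵐᵒᵖ M] : Prop :=
  IsCyclicRightModule R M ∧ ¬ Nonempty (M ≃ₗ[Rᵐᵒᵖ] R)

/-- A right PCI ring: every proper cyclic right module is injective.  The universe of `R` is
large enough, since every cyclic right module is isomorphic to a quotient of `R_R`. -/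
def IsRightPCIRing (R : Type u) [Ring R] : Prop :=
  ∀ (M : Type u) [AddCommGroup M] [Module Rᵐᵒᵖ M],
    IsProperCyclicRightModule R M → Module.Injective Rᵐᵒᵖ M

/-- A ring is right self-injective if `R_R` is an injective right module. -/
def IsRightSelfInjective (R : Type u) [Ring R] : Prop :=
  Module.Injective Rᵐᵒᵖ R

/-- A proper right PCI ring: a right PCI ring that is not right self-injective. -/
def IsProperRightPCIRing (R : Type u) [Ring R] : Prop :=
  IsRightPCIRing R ∧ ¬ IsRightSelfInjective R

/-!
Right `R`-modules are left modules over `S = Rᵐᵒᵖ`, so the argument is about a ring `S` that is not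
left self-injective and all of whose cyclic left modules are injective or isomorphic to `S`.

If `a * b = 0` with `a, b ≠ 0`, then the annihilator `I` of `b` is neither `0` nor `S`. The cyclic
module `S b` is injective, hence a summand of `S`, or isomorphic to `S`; it is projective in both
cases, so `S = I ⊕ J`. Since `S` is not injective, one of the summands, say `I`, is not injective.
As a cyclic module it is then isomorphic to `S`. The isomorphism gives an injective endomorphism
`φ` of `S` with range `I`, and `J, φ J, φ² J, …` is an infinite independent family of nonzero left
ideals. It remains to see that `S` has no such family
(`IsLeftPCIRing.false_of_isCompl_of_not_injective`).

Let `K` be the sum of infinitely many members of the family. It is not finitely generated, so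
`S ⧸ K` is not isomorphic to `S`, and is therefore injective; the remaining members embed in it.
In an injective cyclic module every submodule has a *cyclic* essential extension
(`Submodule.exists_isEssentialIn_span_singleton`). Group infinitely many independent submodules
into infinitely many infinite blocks; the sum `P i` of a block is not finitely generated, so it
differs from its cyclic essential extension `E i`, and there is a maximal submodule `G i` of `E i`
above it. Dividing by all the `G i`, and by a submodule maximal among those that meet the sum of the
`P i` trivially, makes the simple modules `E i ⧸ G i` independent in a quotient by an essential
submodule, which is a singular cyclic module
(`Module.Injective.exists_isEssentialIn_top`).

The gain is that `S` does not embed in a singular module, so all cyclic subfactors of this module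
are injective. Such a module contains no infinite independent family of simple submodules, which
is Osofsky's theorem (`IsSingularModule.false_of_iSupIndep`).
-/

/-! ### Independent families of submodules -/

section Independent

variable {S : Type*} [Ring S] {N : Type*} [AddCommGroup N] [Module S N]

/-- Components of an element of `⨆ i, G i` along the larger independent family `E` lie in `G`. -/
theorem iSupIndep.mem_of_sum_mem_iSup {ι : Type*} {E G : ι → Submodule S N}
    (hE : iSupIndep E) (hGE : ∀ i, G i ≤ E i) {s : Finset ι} {e : ι → N}
    (he : ∀ i ∈ s, e i ∈ E i) (hsum : ∑ i ∈ s, e i ∈ ⨆ i, G i) : ∀ i ∈ s, e i ∈ G i := by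
  classical
  obtain ⟨f, hf, hfs⟩ := (Submodule.mem_iSup_iff_exists_finsupp _ _).mp hsum
  have key := (iSupIndep_iff_finsetSum_eq_imp_eq E).mp hE (s ∪ f.support)
    (fun i => if i ∈ s then e i else 0) f (fun i _ => ⟨by
      split_ifs with h
      · exact he i h
      · exact zero_mem _, hGE i (hf i)⟩) (by
      rw [Finset.sum_ite_mem, Finset.union_inter_cancel_left, ← hfs, Finsupp.sum]
      exact Finset.sum_subset Finset.subset_union_right (by simp))
  intro i hi
  have := key i (Finset.mem_union_left _ hi)
  simp only [hi, if_true] at this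
  exact this ▸ hf i

theorem iSupIndep.inf_iSup_le {ι : Type*} {E G : ι → Submodule S N}
    (hE : iSupIndep E) (hGE : ∀ i, G i ≤ E i) (i : ι) : E i ⊓ ⨆ j, G j ≤ G i := by
  rintro x ⟨hx, hx'⟩
  exact hE.mem_of_sum_mem_iSup hGE (s := {i}) (e := fun _ => x)
    (fun j hj => by rwa [Finset.mem_singleton.mp hj]) (by simpa using hx') i (by simp)

/-- For independent `E i ⊇ G i`, the images of the `E i` in the quotient by the sum of the `G i`
are again independent. -/
theorem iSupIndep.map_mkQ {ι : Type*} {E G : ι → Submodule S N}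
    (hE : iSupIndep E) (hGE : ∀ i, G i ≤ E i) :
    iSupIndep fun i => (E i).map (⨆ j, G j).mkQ := by
  rw [iSupIndep_iff_finsetSum_eq_zero_imp_eq_zero]
  intro s v hv hsum i hi
  choose! e he hev using hv
  have h0 : ∑ i ∈ s, e i ∈ ⨆ j, G j := by
    rw [← Submodule.ker_mkQ (⨆ j, G j), LinearMap.mem_ker, map_sum, ← hsum]
    exact Finset.sum_congr rfl hev
  have := hE.mem_of_sum_mem_iSup hGE he h0 i hi
  rw [← hev i hi, ← LinearMap.mem_ker, Submodule.ker_mkQ]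
  exact le_iSup G i this

theorem iSupIndep.iSup_prod {ι κ : Type*} {A : ι × κ → Submodule S N} (hA : iSupIndep A) :
    iSupIndep fun i => ⨆ j, A (i, j) := by
  intro i
  refine (hA.disjoint_biSup_biSup (s := {p : ι × κ | p.1 = i}) (t := {p : ι × κ | p.1 ≠ i})
    (Set.disjoint_left.mpr fun p (hp : p.1 = i) (hp' : p.1 ≠ i) => hp' hp)).mono ?_ ?_
  · exact iSup_le fun j => le_biSup A (i := (i, j)) (by simp)
  · exact iSup₂_le fun i' hi' => iSup_le fun j => le_biSup A (i := (i', j)) (by simpa using hi')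

theorem Submodule.FG.exists_finset_le_biSup {F : Submodule S N} (hF : F.FG) {ι : Type*}
    {A : ι → Submodule S N} (h : F ≤ ⨆ i, A i) : ∃ s : Finset ι, F ≤ ⨆ i ∈ s, A i :=
  CompleteLattice.IsCompactElement.exists_finset_of_le_iSup _
    ((Submodule.fg_iff_compact F).mp hF) A h

theorem iSupIndep.not_fg_iSup {ι : Type*} [Infinite ι] {A : ι → Submodule S N}
    (hA : iSupIndep A) (hne : ∀ i, A i ≠ ⊥) : ¬ (⨆ i, A i).FG := by
  intro h
  obtain ⟨s, hs⟩ := h.exists_finset_le_biSup le_rfl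
  obtain ⟨i, hi⟩ := Infinite.exists_notMem_finset s
  exact hne i ((hA.disjoint_biSup (y := s) (by simpa using hi)).eq_bot_of_le
    ((le_iSup A i).trans hs))

theorem iSupIndep.option_elim {ι : Type*} {P : ι → Submodule S N} (hP : iSupIndep P)
    {C : Submodule S N} (hC : Disjoint C (⨆ i, P i)) :
    iSupIndep fun o : Option ι => o.elim C P := by
  rintro (_ | i)
  · refine hC.mono_right (iSup₂_le ?_)
    rintro (_ | j) hj
    · exact absurd rfl hj
    · exact le_iSup P j
  · have h1 : Disjoint (P i ⊔ ⨆ (j) (_ : j ≠ i), P j) C :=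
      hC.symm.mono_left (sup_le (le_iSup P i) (iSup₂_le fun j _ => le_iSup P j))
    refine ((hP i).disjoint_sup_right_of_disjoint_sup_left h1).mono_right (iSup₂_le ?_)
    rintro (_ | j) hj
    · exact le_sup_right
    · exact (le_biSup P (i := j) (s := {j | j ≠ i}) fun h => hj (h ▸ rfl)).trans le_sup_left

theorem Submodule.FG.exists_le_covBy {P E : Submodule S N} (hE : E.FG) (h : P < E) :
    ∃ G, P ≤ G ∧ G ⋖ E := by
  have := CompleteLattice.Iic_coatomic_of_compact_element ((Submodule.fg_iff_compact E).mp hE)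
  obtain h1 | ⟨G, hG, hPG⟩ := eq_top_or_exists_le_coatom (⟨P, h.le⟩ : Set.Iic E)
  · exact absurd (congrArg Subtype.val h1) h.ne
  · exact ⟨G, hPG, (covBy_iff_coatom_Iic G.2).mpr hG⟩

/-- If `φ` is injective with range disjoint from `J`, then `J, φ J, φ² J, …` are independent. -/
theorem LinearMap.iSupIndep_map_pow (φ : N →ₗ[S] N) (hφ : Function.Injective φ)
    (J : Submodule S N) (hJ : Disjoint J (LinearMap.range φ)) :
    iSupIndep fun n : ℕ => J.map (φ ^ n) := by
  classical
  rw [iSupIndep_iff_finsetSum_eq_zero_imp_eq_zero]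
  intro s v hv hsum i
  have hinj : ∀ n : ℕ, Function.Injective (φ ^ n) := fun n => by
    rw [Module.End.coe_pow]; exact hφ.iterate n
  induction i using Nat.strong_induction_on with
  | _ i ih =>
    intro hi
    have h1 : ∑ k ∈ s.erase i, v k ∈ LinearMap.range (φ ^ (i + 1)) := by
      refine Submodule.sum_mem _ fun k hk => ?_
      obtain ⟨hki, hks⟩ := Finset.mem_erase.mp hk
      rcases lt_or_gt_of_ne hki with h | h
      · rw [ih k h hks]; exact zero_mem _
      · obtain ⟨j, -, hj⟩ := hv k hks
        refine ⟨(φ ^ (k - (i + 1))) j, ?_⟩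
        rw [← Module.End.mul_apply, ← pow_add, Nat.add_sub_cancel' h, hj]
    obtain ⟨y, hy⟩ := h1
    obtain ⟨j, hjJ, hj⟩ := hv i hi
    rw [← Finset.add_sum_erase s v hi, ← hj, ← hy, pow_succ, Module.End.mul_apply,
      ← map_add] at hsum
    have h2 : j + φ y = 0 := hinj i (by rw [hsum, map_zero])
    have h3 : j = 0 := (Submodule.disjoint_def.mp hJ) j hjJ
      ⟨-y, by rw [map_neg, ← eq_neg_of_add_eq_zero_left h2]⟩
    rw [← hj, h3, map_zero]

end Independent

/-! ### Essential submodules -/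

section Essential

variable {S : Type*} [Ring S] {N : Type*} [AddCommGroup N] [Module S N]

/-- `X` is an essential submodule of `E`: it is contained in `E`, and every nonzero element of `E`
has a nonzero multiple in `X`. -/
def Submodule.IsEssentialIn (X E : Submodule S N) : Prop :=
  X ≤ E ∧ ∀ z ∈ E, z ≠ 0 → ∃ r : S, r • z ∈ X ∧ r • z ≠ 0

theorem Submodule.IsEssentialIn.disjoint {X X' Y Y' : Submodule S N} (hX : X.IsEssentialIn X')
    (hY : Y.IsEssentialIn Y') (h : Disjoint X Y) : Disjoint X' Y' := by
  rw [Submodule.disjoint_def] at h ⊢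
  intro z hz hz'
  by_contra h0
  obtain ⟨r, hr, hr0⟩ := hX.2 z hz h0
  obtain ⟨t, ht, ht0⟩ := hY.2 (r • z) (Y'.smul_mem r hz') hr0
  exact ht0 (h _ (X.smul_mem t hr) ht)

theorem Submodule.IsEssentialIn.sup {X X' Y Y' : Submodule S N} (hX : X.IsEssentialIn X')
    (hY : Y.IsEssentialIn Y') (h : Disjoint X Y) : (X ⊔ Y).IsEssentialIn (X' ⊔ Y') := by
  have h' := hX.disjoint hY h
  refine ⟨sup_le_sup hX.1 hY.1, fun z hz hz0 => ?_⟩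
  obtain ⟨x, hx, y, hy, rfl⟩ := Submodule.mem_sup.mp hz
  by_cases hx0 : x = 0
  · subst hx0
    rw [zero_add] at hz0
    obtain ⟨r, hr, hr0⟩ := hY.2 y hy hz0
    exact ⟨r, by simpa using Submodule.mem_sup_right hr, by simpa using hr0⟩
  obtain ⟨r, hr, hr0⟩ := hX.2 x hx hx0
  by_cases hy0 : r • y = 0
  · exact ⟨r, by simpa [hy0] using Submodule.mem_sup_left hr, by simpa [hy0] using hr0⟩
  obtain ⟨t, ht, ht0⟩ := hY.2 _ (Y'.smul_mem r hy) hy0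
  refine ⟨t * r, ?_, fun h0 => ht0 ?_⟩
  · rw [mul_smul, smul_add, smul_add]
    exact Submodule.add_mem_sup (X.smul_mem t hr) ht
  · rw [mul_smul, smul_add, smul_add] at h0
    refine Submodule.disjoint_def.mp h' _ ?_ (hY.1 ht)
    rw [eq_neg_of_add_eq_zero_right h0]
    exact X'.neg_mem (hX.1 (X.smul_mem t hr))

theorem Submodule.IsEssentialIn.iSup {ι : Type*} {P E : ι → Submodule S N} (hP : iSupIndep P)
    (h : ∀ i, (P i).IsEssentialIn (E i)) : (⨆ i, P i).IsEssentialIn (⨆ i, E i) := by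
  classical
  have key : ∀ s : Finset ι, (⨆ i ∈ s, P i).IsEssentialIn (⨆ i ∈ s, E i) := by
    intro s
    induction s using Finset.induction_on with
    | empty => exact ⟨by simp, fun z hz hz0 => absurd (by simpa using hz) hz0⟩
    | insert i s hi ih =>
      rw [Finset.iSup_insert, Finset.iSup_insert]
      exact (h i).sup ih (hP.disjoint_biSup (y := s) (by simpa using hi))
  refine ⟨iSup_mono fun i => (h i).1, fun z hz hz0 => ?_⟩
  obtain ⟨s, hs⟩ := Submodule.mem_iSup_iff_exists_finset.mp hz
  obtain ⟨r, hr, hr0⟩ := (key s).2 z hs hz0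
  exact ⟨r, Submodule.mem_iSup_iff_exists_finset.mpr ⟨s, hr⟩, hr0⟩

theorem iSupIndep.of_isEssentialIn {ι : Type*} {P E : ι → Submodule S N} (hP : iSupIndep P)
    (h : ∀ i, (P i).IsEssentialIn (E i)) : iSupIndep E := by
  intro i
  have h1 : iSupIndep fun j : {j // j ≠ i} => P j := hP.comp Subtype.val_injective
  have h2 := Submodule.IsEssentialIn.iSup h1 (fun j => h j)
  rw [iSup_subtype, iSup_subtype] at h2
  exact (h i).disjoint h2 (hP i)

/-- There is a submodule `C` maximal among those that meet `X` trivially. Maximality is stated as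
it is used: adjoining any `n ∉ C` to `C` produces a nonzero element of `X`. -/
theorem Submodule.exists_maximal_disjoint (X : Submodule S N) :
    ∃ C : Submodule S N, Disjoint C X ∧
      ∀ n ∉ C, ∃ r : S, ∃ c ∈ C, c + r • n ∈ X ∧ c + r • n ≠ 0 := by
  obtain ⟨C, -, hC⟩ := zorn_le_nonempty₀ {C : Submodule S N | Disjoint C X} (by
    intro c hc hchain y hy
    exact ⟨sSup c, hchain.directedOn.disjoint_sSup_left.mpr fun b hb => hc hb,
      fun z hz => le_sSup hz⟩) ⊥ disjoint_bot_left
  refine ⟨C, hC.prop, fun n hn => ?_⟩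
  have h1 : ¬ Disjoint (C ⊔ Submodule.span S {n}) X := fun hd =>
    hn (hC.le_of_ge hd le_sup_left (Submodule.mem_sup_right (Submodule.mem_span_singleton_self n)))
  rw [Submodule.disjoint_def] at h1
  push Not at h1
  obtain ⟨x, hx, hxX, hx0⟩ := h1
  obtain ⟨c, hc, y, hy, rfl⟩ := Submodule.mem_sup.mp hx
  obtain ⟨r, rfl⟩ := Submodule.mem_span_singleton.mp hy
  exact ⟨r, c, hc, hxX, hx0⟩

end Essential

/-! ### Cyclic, injective and projective modules -/

section Injective

variable {S : Type u} [Ring S] {N : Type u} [AddCommGroup N] [Module S N]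

theorem Module.Injective.of_linearEquiv {M : Type u} [AddCommGroup M] [Module S M]
    (e : M ≃ₗ[S] N) (h : Module.Injective S M) : Module.Injective S N :=
  ((Module.Baer.of_injective h).of_equiv e).injective

/-- Inside an injective submodule `F` of a cyclic module, every submodule has an essential
extension that is cyclic: for `C` maximal among the submodules that meet `X` trivially, the
inclusion of `X` extends along `X → N ⧸ C` to a map `N ⧸ C → F`, whose range is cyclic. -/
theorem Submodule.exists_isEssentialIn_span_singleton {u : N} (hu : Submodule.span S {u} = ⊤)
    (F : Submodule S N) (hF : Module.Injective S F) {X : Submodule S N} (hX : X ≤ F) :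
    ∃ e ∈ F, X.IsEssentialIn (Submodule.span S {e}) := by
  obtain ⟨C, hCX, hC⟩ := X.exists_maximal_disjoint
  have hinj : Function.Injective (C.mkQ ∘ₗ X.subtype) := by
    rw [← LinearMap.ker_eq_bot, LinearMap.ker_eq_bot']
    intro x hx
    have : (x : N) ∈ C := by simpa using hx
    exact Subtype.ext (Submodule.disjoint_def.mp hCX x this x.2)
  obtain ⟨g, hg⟩ := hF.out (C.mkQ ∘ₗ X.subtype) hinj (Submodule.inclusion hX)
  let f : N →ₗ[S] N := F.subtype ∘ₗ g ∘ₗ C.mkQ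
  have hfX : ∀ x ∈ X, f x = x := fun x hx => congrArg Subtype.val (hg ⟨x, hx⟩)
  have hfC : ∀ c ∈ C, f c = 0 := fun c hc => by
    have : C.mkQ c = 0 := by simpa using hc
    simp only [f, LinearMap.comp_apply, this, map_zero]
  have hspan : Submodule.span S {f u} = LinearMap.range f := by
    rw [LinearMap.range_eq_map, ← hu, Submodule.map_span, Set.image_singleton]
  refine ⟨f u, (g (C.mkQ u)).2, ?_⟩
  rw [hspan]
  refine ⟨fun x hx => ⟨x, hfX x hx⟩, ?_⟩
  rintro _ ⟨n, rfl⟩ hn0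
  obtain ⟨r, c, hc, hx, hx0⟩ := hC n (fun hn => hn0 (hfC n hn))
  have h1 : r • f n = c + r • n := by
    rw [← hfX _ hx, map_add, hfC c hc, zero_add, map_smul]
  exact ⟨r, h1 ▸ hx, h1 ▸ hx0⟩

/-- A finite direct sum of injective submodules is a direct summand, stated as the existence of a
retraction `ρ` onto it. -/
theorem Submodule.exists_retraction_biSup {ι : Type*} {U : ι → Submodule S N}
    (hU : iSupIndep U) (hinj : ∀ i, Module.Injective S (U i)) (s : Finset ι) :
    ∃ ρ : N →ₗ[S] N, (∀ x, ρ x ∈ ⨆ i ∈ s, U i) ∧ ∀ x ∈ ⨆ i ∈ s, U i, ρ x = x := by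
  classical
  induction s using Finset.induction_on with
  | empty => exact ⟨0, by simp, by simp +contextual⟩
  | insert i s hi ih =>
    obtain ⟨ρ, hρ, hρ'⟩ := ih
    set X := ⨆ i ∈ s, U i
    have hd : Disjoint (U i) X := hU.disjoint_biSup (y := s) (by simpa using hi)
    have hj : Function.Injective (X.mkQ ∘ₗ (U i).subtype) := by
      rw [← LinearMap.ker_eq_bot, LinearMap.ker_eq_bot']
      intro x hx
      have : (x : N) ∈ X := by simpa using hx
      exact Subtype.ext (Submodule.disjoint_def.mp hd x x.2 this)
    obtain ⟨g, hg⟩ := (hinj i).out (X.mkQ ∘ₗ (U i).subtype) hj LinearMap.id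
    -- `τ` is a projection onto `U i` that kills `X`
    let τ : N →ₗ[S] N := (U i).subtype ∘ₗ g ∘ₗ X.mkQ
    have hτ : ∀ x, τ x ∈ U i := fun x => (g (X.mkQ x)).2
    have hτU : ∀ x ∈ U i, τ x = x := fun x hx => congrArg Subtype.val (hg ⟨x, hx⟩)
    have hτX : ∀ x ∈ X, τ x = 0 := fun x hx => by
      have : X.mkQ x = 0 := by simpa using hx
      simp only [τ, LinearMap.comp_apply, this, map_zero]
    rw [Finset.iSup_insert]
    refine ⟨ρ ∘ₗ (LinearMap.id - τ) + τ, fun x => ?_, fun x hx => ?_⟩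
    · exact add_mem (Submodule.mem_sup_right (hρ _)) (Submodule.mem_sup_left (hτ x))
    · obtain ⟨y, hy, z, hz, rfl⟩ := Submodule.mem_sup.mp hx
      have h1 : τ (y + z) = y := by rw [map_add, hτU y hy, hτX z hz, add_zero]
      change ρ (y + z - τ (y + z)) + τ (y + z) = y + z
      rw [h1, add_sub_cancel_left, hρ' z hz, add_comm]

theorem Module.Injective.prod {M N : Type u} [AddCommGroup M] [Module S M] [AddCommGroup N]
    [Module S N] (hM : Module.Injective S M) (hN : Module.Injective S N) :
    Module.Injective S (M × N) :=
  ⟨fun X Y _ _ _ _ f hf g => by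
    obtain ⟨h₁, hh₁⟩ := hM.out f hf (LinearMap.fst S M N ∘ₗ g)
    obtain ⟨h₂, hh₂⟩ := hN.out f hf (LinearMap.snd S M N ∘ₗ g)
    exact ⟨h₁.prod h₂, fun x => Prod.ext (hh₁ x) (hh₂ x)⟩⟩

theorem Submodule.span_singleton_coe_eq_top (v : N) :
    Submodule.span S {(⟨v, Submodule.mem_span_singleton_self v⟩ : Submodule.span S {v})} = ⊤ := by
  rw [eq_top_iff]
  rintro ⟨x, hx⟩ -
  obtain ⟨r, rfl⟩ := Submodule.mem_span_singleton.mp hx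
  exact Submodule.mem_span_singleton.mpr ⟨r, rfl⟩

theorem Submodule.span_singleton_mkQ_eq_top {u : N} (hu : Submodule.span S {u} = ⊤)
    (K : Submodule S N) : Submodule.span S {K.mkQ u} = ⊤ := by
  rw [← Set.image_singleton, ← Submodule.map_span, hu, Submodule.map_top, Submodule.range_mkQ]

theorem LinearMap.exists_isCompl_ker_of_projective {M P : Type*} [AddCommGroup M] [Module S M]
    [AddCommGroup P] [Module S P] [Module.Projective S P] (f : M →ₗ[S] P)
    (hf : LinearMap.range f = ⊤) : ∃ J, IsCompl (LinearMap.ker f) J := by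
  obtain ⟨g, hg⟩ := f.exists_rightInverse_of_surjective hf
  have hg' : ∀ y, f (g y) = y := fun y => LinearMap.congr_fun hg y
  refine ⟨LinearMap.range g, ?_, ?_⟩
  · rw [Submodule.disjoint_def]
    rintro _ hx ⟨y, rfl⟩
    rw [LinearMap.mem_ker, hg'] at hx
    rw [hx, map_zero]
  · rw [codisjoint_iff, eq_top_iff]
    intro x _
    rw [← sub_add_cancel x (g (f x))]
    exact Submodule.add_mem_sup (by rw [LinearMap.mem_ker, map_sub, hg', sub_self]) ⟨_, rfl⟩

/-- An infinite independent family of nonzero submodules of an injective cyclic module gives rise to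
an infinite independent family of nonzero Noetherian (in fact simple) submodules of a quotient by
an essential submodule. -/
theorem Module.Injective.exists_isEssentialIn_top {M : Type u} [AddCommGroup M] [Module S M]
    (hM : Module.Injective S M) {u : M} (hu : Submodule.span S {u} = ⊤)
    {A : ℕ × ℕ → Submodule S M} (hA : iSupIndep A) (hne : ∀ p, A p ≠ ⊥) :
    ∃ K : Submodule S M, K.IsEssentialIn ⊤ ∧ ∃ B : ℕ → Submodule S (M ⧸ K),
      iSupIndep B ∧ (∀ i, B i ≠ ⊥) ∧ ∀ i, IsNoetherian S (B i) := by
  have htop := hM.of_linearEquiv (Submodule.topEquiv (R := S) (M := M)).symm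
  let P : ℕ → Submodule S M := fun i => ⨆ j, A (i, j)
  have hP : iSupIndep P := hA.iSup_prod
  have hPfg : ∀ i, ¬ (P i).FG := fun i =>
    (hA.comp (f := fun j => (i, j)) (Prod.mk_right_injective i)).not_fg_iSup fun j => hne _
  choose e he hPE using fun i => Submodule.exists_isEssentialIn_span_singleton hu ⊤ htop
    (le_top : P i ≤ ⊤)
  let E : ℕ → Submodule S M := fun i => Submodule.span S {e i}
  have hEfg : ∀ i, (E i).FG := fun i => Submodule.fg_span_singleton _
  have hlt : ∀ i, P i < E i := fun i =>
    lt_of_le_of_ne (hPE i).1 fun h => hPfg i (h ▸ hEfg i)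
  choose G hPG hGE using fun i => (hEfg i).exists_le_covBy (hlt i)
  obtain ⟨C, hCP, hC⟩ := (⨆ i, P i).exists_maximal_disjoint
  have hE : iSupIndep fun o : Option ℕ => o.elim C E :=
    (hP.option_elim hCP).of_isEssentialIn (by
      rintro (_ | i)
      · exact ⟨le_rfl, fun z hz hz0 => ⟨1, by simpa using hz, by simpa using hz0⟩⟩
      · exact hPE i)
  have hGE' : ∀ o : Option ℕ, o.elim C G ≤ o.elim C E := by
    rintro (_ | i)
    · exact le_rfl
    · exact (hGE i).le
  -- `C` is divided out completely, which makes `K` essential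
  let K : Submodule S M := ⨆ o : Option ℕ, o.elim C G
  have hGK : ∀ i, G i ≤ K := fun i => le_iSup (fun o : Option ℕ => o.elim C G) (some i)
  have hCK : C ≤ K := le_iSup (fun o : Option ℕ => o.elim C G) none
  refine ⟨K, ⟨le_top, fun n _ hn0 => ?_⟩, fun i => (E i).map K.mkQ,
    (hE.map_mkQ hGE').comp (Option.some_injective ℕ), fun i h => ?_, fun i => ?_⟩
  · by_cases hn : n ∈ C
    · exact ⟨1, by simpa using hCK hn, by simpa using hn0⟩
    · obtain ⟨r, c, hc, hx, hx0⟩ := hC n hn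
      refine ⟨r, ?_, fun h0 => ?_⟩
      · rw [← add_sub_cancel_left c (r • n)]
        exact sub_mem (iSup_le (fun i => (hPG i).trans (hGK i)) hx) (hCK hc)
      · rw [h0, add_zero] at hx hx0
        exact hx0 (Submodule.disjoint_def.mp hCP c hc hx)
  · have h1 : E i ≤ K := by
      have h0 : (E i).map K.mkQ = ⊥ := h
      rwa [← le_bot_iff, Submodule.map_le_iff_le_comap, Submodule.comap_bot,
        Submodule.ker_mkQ] at h0
    exact (hGE i).lt.not_ge ((le_inf le_rfl h1).trans (hE.inf_iSup_le hGE' (some i)))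
  · have hs : IsSimpleModule S (E i ⧸ (G i).submoduleOf (E i)) :=
      (covBy_iff_quot_is_simple (hGE i).le).mp (hGE i)
    have hN : IsNoetherian S (E i ⧸ (G i).submoduleOf (E i)) :=
      inferInstance
    have hle : (G i).submoduleOf (E i) ≤ LinearMap.ker (K.mkQ.submoduleMap (E i)) := by
      intro x hx
      exact Subtype.ext ((Submodule.Quotient.mk_eq_zero K).mpr (hGK i hx))
    refine isNoetherian_of_surjective (f := ((G i).submoduleOf (E i)).liftQ _ hle) ?_
    rw [Submodule.range_liftQ]
    exact LinearMap.range_eq_top.mpr (LinearMap.submoduleMap_surjective _ _)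

end Injective

/-! ### Singular modules -/

section Singular

variable {S : Type u} [Ring S] {N : Type u} [AddCommGroup N] [Module S N]

/-- A singular module: the annihilator of each element is an essential left ideal. -/
def IsSingularModule (S : Type u) [Ring S] (N : Type u) [AddCommGroup N] [Module S N] : Prop :=
  ∀ m : N, ∀ a : S, a ≠ 0 → ∃ b : S, b * a ≠ 0 ∧ (b * a) • m = 0

theorem IsSingularModule.submodule (h : IsSingularModule S N) (F : Submodule S N) :
    IsSingularModule S F := fun m a ha => by
  obtain ⟨b, hb, hb'⟩ := h m a ha
  exact ⟨b, hb, Subtype.ext hb'⟩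

theorem IsSingularModule.quotient (h : IsSingularModule S N) (F : Submodule S N) :
    IsSingularModule S (N ⧸ F) := fun m a ha => by
  obtain ⟨m, rfl⟩ := F.mkQ_surjective m
  obtain ⟨b, hb, hb'⟩ := h m a ha
  exact ⟨b, hb, by rw [← map_smul, hb', map_zero]⟩

theorem Submodule.IsEssentialIn.isSingularModule_quotient {K : Submodule S N}
    (h : K.IsEssentialIn ⊤) : IsSingularModule S (N ⧸ K) := fun m a ha => by
  obtain ⟨m, rfl⟩ := K.mkQ_surjective m
  by_cases h0 : a • m = 0
  · exact ⟨1, by rwa [one_mul], by rw [one_mul, ← map_smul, h0, map_zero]⟩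
  · obtain ⟨b, hb, hb0⟩ := h.2 (a • m) trivial h0
    rw [← mul_smul] at hb hb0
    exact ⟨b, fun h1 => hb0 (by rw [h1, zero_smul]), by
      rw [← map_smul]; exact (Submodule.Quotient.mk_eq_zero K).mpr hb⟩

theorem IsSingularModule.not_linearEquiv_self [Nontrivial S] (h : IsSingularModule S N) :
    ¬ Nonempty (N ≃ₗ[S] S) := by
  rintro ⟨e⟩
  obtain ⟨b, hb, hb'⟩ := h (e.symm 1) 1 one_ne_zero
  refine hb ?_
  rw [← map_smul, LinearEquiv.map_eq_zero_iff] at hb'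
  simpa using hb'

/-- Osofsky's theorem for singular modules: if all singular cyclic modules are injective, then a
singular cyclic module has no infinite independent family of nonzero Noetherian submodules.

The family is arranged in rows; `P i` is the sum of a row and `E i` its cyclic essential extension.
In the quotient by the sum of all the `P i`, the images of the `E i` generate a submodule that has a
cyclic essential extension, generated by the image of some `v`. Then `F = S v` meets each `P i`:
otherwise `P i` would embed in a quotient of finitely many `C p` and be finitely generated. Take
cyclic submodules `U i ≠ 0` of `P i ⊓ F`, and a cyclic essential extension `S h ≤ F` of their sum.
The element `h` does not lie in the sum of the `P i`, but a multiple of it outside that sum lies in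
the sum of finitely many `E i`, where the corresponding `U i`, being injective, split off. -/
theorem IsSingularModule.false_of_iSupIndep
    (hS : ∀ (M : Type u) [AddCommGroup M] [Module S M], (∃ m : M, Submodule.span S {m} = ⊤) →
      IsSingularModule S M → Module.Injective S M)
    {u : N} (hu : Submodule.span S {u} = ⊤) (hN : IsSingularModule S N)
    {C : ℕ × ℕ → Submodule S N} (hC : iSupIndep C) (hne : ∀ p, C p ≠ ⊥)
    (hnoeth : ∀ p, IsNoetherian S (C p)) : False := by
  have hspan : ∀ v : N, Module.Injective S (Submodule.span S {v}) := fun v =>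
    hS _ ⟨_, Submodule.span_singleton_coe_eq_top v⟩ (hN.submodule _)
  have htop : Module.Injective S (⊤ : Submodule S N) :=
    (hS N ⟨u, hu⟩ hN).of_linearEquiv Submodule.topEquiv.symm
  let P : ℕ → Submodule S N := fun i => ⨆ j, C (i, j)
  have hP : iSupIndep P := hC.iSup_prod
  have hPfg : ∀ i, ¬ (P i).FG := fun i =>
    (hC.comp (f := fun j => (i, j)) (Prod.mk_right_injective i)).not_fg_iSup fun j => hne _
  let PP : Submodule S N := ⨆ i, P i
  choose e he hPE using fun i => Submodule.exists_isEssentialIn_span_singleton hu ⊤ htop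
    (le_top : P i ≤ ⊤)
  let E : ℕ → Submodule S N := fun i => Submodule.span S {e i}
  have hE : iSupIndep E := hP.of_isEssentialIn hPE
  -- a cyclic essential extension of the sum of the `E i` modulo the `P i`, generated by `v`
  obtain ⟨v, hv⟩ : ∃ v : N, (((⨆ i, E i).map PP.mkQ).IsEssentialIn
      (Submodule.span S {PP.mkQ v})) := by
    have hQ : Module.Injective S (⊤ : Submodule S (N ⧸ PP)) :=
      (hS _ ⟨_, Submodule.span_singleton_mkQ_eq_top hu PP⟩ (hN.quotient PP)).of_linearEquiv
        Submodule.topEquiv.symm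
    obtain ⟨w, -, hw⟩ := Submodule.exists_isEssentialIn_span_singleton
      (Submodule.span_singleton_mkQ_eq_top hu PP) ⊤ hQ
      (le_top : (⨆ i, E i).map PP.mkQ ≤ ⊤)
    obtain ⟨v, rfl⟩ := PP.mkQ_surjective w
    exact ⟨v, hw⟩
  let F : Submodule S N := Submodule.span S {v}
  have hFmap : Submodule.span S {PP.mkQ v} = F.map PP.mkQ := by
    rw [Submodule.map_span, Set.image_singleton]
  rw [hFmap] at hv
  have hEF : ∀ i, E i ≤ F ⊔ PP := fun i x hx => by
    obtain ⟨y, hy, hxy⟩ := hv.1 (Submodule.mem_map_of_mem (le_iSup E i hx))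
    have h1 : x - y ∈ PP := by
      rw [← Submodule.ker_mkQ PP, LinearMap.mem_ker, map_sub, hxy, sub_self]
    rw [← add_sub_cancel y x]
    exact Submodule.add_mem_sup hy h1
  -- if `P i` met `F` trivially, it would embed in `(F ⊔ ⨆ p ∈ t, C p) ⧸ F`, which is Noetherian
  have hPF : ∀ i, ∃ w ∈ P i, w ∈ F ∧ w ≠ 0 := by
    intro i
    by_contra! hcon
    have hd : Disjoint (P i) F := Submodule.disjoint_def.mpr fun w hw hwF => hcon w hw hwF
    have hPP : PP = ⨆ p, C p := iSup_prod.symm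
    obtain ⟨t, ht⟩ : ∃ t : Finset (ℕ × ℕ), E i ≤ F ⊔ ⨆ p ∈ t, C p := by
      have hmem : e i ∈ F ⊔ ⨆ p, C p := hPP ▸ hEF i (Submodule.mem_span_singleton_self _)
      obtain ⟨y, hy, z, hz, hyz⟩ := Submodule.mem_sup.mp hmem
      obtain ⟨t, ht⟩ := Submodule.mem_iSup_iff_exists_finset.mp hz
      exact ⟨t, (Submodule.span_singleton_le_iff_mem _ _).mpr (hyz ▸ Submodule.add_mem_sup hy ht)⟩
    have hCt : IsNoetherian S (⨆ p ∈ t, C p : Submodule S N) := by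
      have : ∀ p : t, IsNoetherian S (C p) := fun p => hnoeth p
      have h2 : (⨆ p ∈ t, C p) = ⨆ p : t, C p := (iSup_subtype' ..)
      rw [h2]
      exact isNoetherian_iSup
    have hmapN : IsNoetherian S ((⨆ p ∈ t, C p).map F.mkQ) :=
      isNoetherian_of_surjective (f := F.mkQ.submoduleMap _)
        (LinearMap.range_eq_top.mpr (LinearMap.submoduleMap_surjective _ _))
    have hmem : ∀ x : P i, (F.mkQ ∘ₗ (P i).subtype) x ∈ (⨆ p ∈ t, C p).map F.mkQ := by
      intro x
      obtain ⟨y, hy, z, hz, hyz⟩ := Submodule.mem_sup.mp (ht ((hPE i).1 x.2))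
      refine ⟨z, hz, ?_⟩
      have : F.mkQ y = 0 := by simpa using hy
      change F.mkQ z = F.mkQ x
      rw [← hyz, map_add, this, zero_add]
    have hPN : IsNoetherian S (P i) := by
      refine isNoetherian_of_injective (LinearMap.codRestrict _ _ hmem) ?_
      rw [LinearMap.injective_codRestrict_iff, ← LinearMap.ker_eq_bot, LinearMap.ker_eq_bot']
      intro x hx
      have : (x : N) ∈ F := by simpa using hx
      exact Subtype.ext (Submodule.disjoint_def.mp hd x x.2 this)
    exact hPfg i (Module.Finite.iff_fg.mp inferInstance)
  choose w hwP hwF hw0 using hPF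
  let U : ℕ → Submodule S N := fun i => Submodule.span S {w i}
  have hUP : ∀ i, U i ≤ P i := fun i => (Submodule.span_singleton_le_iff_mem _ _).mpr (hwP i)
  have hUE : ∀ i, U i ≤ E i := fun i => (hUP i).trans (hPE i).1
  have hU0 : ∀ i, U i ≠ ⊥ := fun i => by simpa [U] using hw0 i
  have hU : iSupIndep U := hP.mono hUP
  have hUF : ⨆ i, U i ≤ F := iSup_le fun i =>
    (Submodule.span_singleton_le_iff_mem _ _).mpr (hwF i)
  obtain ⟨h, hhF, hUH⟩ := Submodule.exists_isEssentialIn_span_singleton hu F (hspan v) hUF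
  -- `h` generates a finitely generated module, which is too small to contain all the `U i`
  have hhP : h ∉ PP := by
    intro hcon
    obtain ⟨s, hs⟩ := Submodule.mem_iSup_iff_exists_finset.mp hcon
    obtain ⟨i, hi⟩ := Infinite.exists_notMem_finset s
    refine hU0 i (((hP.disjoint_biSup (y := s) (by simpa using hi)).mono_left (hUP i)).eq_bot_of_le
      (((le_iSup U i).trans hUH.1).trans ?_))
    exact (Submodule.span_singleton_le_iff_mem _ _).mpr hs
  obtain ⟨r, hr, hr0⟩ := hv.2 (PP.mkQ h) (Submodule.mem_map_of_mem hhF)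
    (fun h0 => hhP (by simpa using h0))
  rw [← map_smul] at hr hr0
  have hrE : r • h ∈ ⨆ i, E i := by
    obtain ⟨y, hy, hxy⟩ := hr
    have h1 : r • h - y ∈ PP := by
      rw [← Submodule.ker_mkQ PP, LinearMap.mem_ker, map_sub, hxy, sub_self]
    rw [← add_sub_cancel y (r • h)]
    exact add_mem hy (iSup_mono (fun i => (hPE i).1) h1)
  have hrP : r • h ∉ PP := fun hcon =>
    hr0 ((Submodule.Quotient.mk_eq_zero PP).mpr hcon)
  obtain ⟨s, hs⟩ := Submodule.mem_iSup_iff_exists_finset.mp hrE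
  -- the sum of the `U i`, `i ∈ s`, is a direct summand, and essential in the part of
  -- `S h` that lies in the sum of the `E i`, `i ∈ s`
  obtain ⟨ρ, hρ, hρ'⟩ := Submodule.exists_retraction_biSup hU (fun i => hspan (w i)) s
  have hUs : (⨆ i, U i) ⊓ (⨆ i ∈ s, E i) ≤ ⨆ i ∈ s, U i := by
    have h1 : (⨆ i, U i) = (⨆ i ∈ s, U i) ⊔ ⨆ i ∈ (s : Set ℕ)ᶜ, U i := by
      refine le_antisymm (iSup_le fun i => ?_)
        (sup_le (iSup₂_le fun i _ => le_iSup U i) (iSup₂_le fun i _ => le_iSup U i))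
      by_cases hi : i ∈ s
      · exact (le_biSup U hi).trans le_sup_left
      · exact (le_biSup U (i := i) (s := (s : Set ℕ)ᶜ) (by simpa using hi)).trans le_sup_right
    have h2 : Disjoint (⨆ i ∈ (s : Set ℕ)ᶜ, U i) (⨆ i ∈ s, E i) :=
      (hE.disjoint_biSup_biSup (s := (s : Set ℕ)ᶜ) (t := s) disjoint_compl_left).mono_left
        (iSup₂_mono fun i _ => hUE i)
    rw [h1, sup_inf_assoc_of_le _ (iSup₂_mono fun i _ => hUE i), h2.eq_bot, sup_bot_eq]
  have hUsE : (⨆ i ∈ s, U i) ≤ ⨆ i ∈ s, E i := iSup₂_mono fun i _ => hUE i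
  have hUsU : (⨆ i ∈ s, U i) ≤ ⨆ i, U i := iSup₂_le fun i _ => le_iSup U i
  have hq : r • h - ρ (r • h) = 0 := by
    by_contra hq
    obtain ⟨t, ht, ht0⟩ := hUH.2 _ (sub_mem (Submodule.smul_mem _ r
      (Submodule.mem_span_singleton_self h)) (hUH.1 (hUsU (hρ (r • h))))) hq
    have h1 := hρ' _ (hUs ⟨ht, Submodule.smul_mem _ t (sub_mem hs (hUsE (hρ _)))⟩)
    rw [map_smul, map_sub, hρ' _ (hρ _), sub_self, smul_zero] at h1
    exact ht0 h1.symm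
  refine hrP ?_
  rw [sub_eq_zero.mp hq]
  exact (hUsU.trans (iSup_mono hUP)) (hρ _)

end Singular

/-! ### Left PCI rings -/

section PCI

variable {S : Type u} [Ring S]

/-- A left PCI ring: every cyclic left module that is not isomorphic to the ring itself is
injective. -/
def IsLeftPCIRing (S : Type u) [Ring S] : Prop :=
  ∀ (M : Type u) [AddCommGroup M] [Module S M], (∃ m : M, Submodule.span S {m} = ⊤) →
    ¬ Nonempty (M ≃ₗ[S] S) → Module.Injective S M

/-- Annihilators of elements are direct summands, because principal left ideals are projective. -/
theorem IsLeftPCIRing.exists_isCompl_ker_toSpanSingleton (hS : IsLeftPCIRing S) (b : S) :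
    ∃ J, IsCompl (LinearMap.ker (LinearMap.toSpanSingleton S S b)) J := by
  let f := LinearMap.toSpanSingleton S S b
  have hproj : Module.Projective S (Submodule.span S {b}) := by
    by_cases h : Nonempty (Submodule.span S {b} ≃ₗ[S] S)
    · exact Module.Projective.of_equiv h.some.symm
    · have hinj := hS _ ⟨_, Submodule.span_singleton_coe_eq_top b⟩ h
      obtain ⟨p, hp⟩ := hinj.out (Submodule.span S {b}).subtype Subtype.val_injective LinearMap.id
      exact Module.Projective.of_split _ p (LinearMap.ext hp)
  have hmem : ∀ x, f x ∈ Submodule.span S {b} := fun x =>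
    Submodule.smul_mem _ x (Submodule.mem_span_singleton_self b)
  obtain ⟨J, hJ⟩ := (f.codRestrict _ hmem).exists_isCompl_ker_of_projective (by
    rw [LinearMap.range_eq_top]
    rintro ⟨x, hx⟩
    obtain ⟨r, rfl⟩ := Submodule.mem_span_singleton.mp hx
    exact ⟨r, rfl⟩)
  rw [LinearMap.ker_codRestrict] at hJ
  exact ⟨J, hJ⟩

/-- If `S = I ⊕ J` with `I` not injective, then `I` is isomorphic to `S`, and unless `J = 0`
iterating the isomorphism yields infinitely many independent left ideals, which is impossible. -/
theorem IsLeftPCIRing.false_of_isCompl_of_not_injective [Nontrivial S] (hS : IsLeftPCIRing S)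
    {I J : Submodule S S} (hIJ : IsCompl I J) (hJ : J ≠ ⊥) (hI : ¬ Module.Injective S I) :
    False := by
  have h1 : Submodule.span S {(1 : S)} = ⊤ := Ideal.span_singleton_one
  obtain ⟨e⟩ : Nonempty (S ≃ₗ[S] I) := by
    by_contra hcon
    refine hI (((hS (S ⧸ J) ⟨_, Submodule.span_singleton_mkQ_eq_top h1 J⟩ fun ⟨e⟩ =>
      hcon ⟨?_⟩)).of_linearEquiv (Submodule.quotientEquivOfIsCompl J I hIJ.symm))
    exact e.symm.trans (Submodule.quotientEquivOfIsCompl J I hIJ.symm)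
  let φ : S →ₗ[S] S := I.subtype ∘ₗ e.toLinearMap
  have hφ : Function.Injective φ := Subtype.val_injective.comp e.injective
  have hφI : LinearMap.range φ ≤ I := by
    rintro _ ⟨x, rfl⟩
    exact (e x).2
  -- the `A (none, j)` are divided out, so that the quotient is injective;
  -- the `A (some i, j)` survive
  let A : Option ℕ × ℕ → Submodule S S := fun p => J.map (φ ^ Denumerable.eqv (Option ℕ × ℕ) p)
  have hA : iSupIndep A :=
    (φ.iSupIndep_map_pow hφ J (hIJ.symm.disjoint.mono_right hφI)).comp (Equiv.injective _)
  have hA0 : ∀ p, A p ≠ ⊥ := fun p h => by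
    refine hJ (Submodule.map_injective_of_injective (f := φ ^ Denumerable.eqv (Option ℕ × ℕ) p)
      ?_ (h.trans (Submodule.map_bot _).symm))
    rw [Module.End.coe_pow]
    exact hφ.iterate _
  let G : Option ℕ × ℕ → Submodule S S := fun p => p.1.elim (A p) fun _ => ⊥
  have hGA : ∀ p, G p ≤ A p := by
    rintro ⟨_ | i, j⟩
    · exact le_rfl
    · exact bot_le
  let K : Submodule S S := ⨆ p, G p
  have hKfg : ¬ K.FG := by
    have h2 : K = ⨆ j, A (none, j) := by
      simp [K, G, iSup_prod, iSup_option]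
    rw [h2]
    exact (hA.comp (f := fun j => (none, j)) (Prod.mk_right_injective none)).not_fg_iSup
      fun j => hA0 _
  have hM : Module.Injective S (S ⧸ K) := by
    refine hS _ ⟨_, Submodule.span_singleton_mkQ_eq_top h1 K⟩ fun ⟨e⟩ => hKfg ?_
    have : Module.Projective S (S ⧸ K) := Module.Projective.of_equiv e.symm
    obtain ⟨L, hL⟩ := K.mkQ.exists_isCompl_ker_of_projective K.range_mkQ
    rw [Submodule.ker_mkQ] at hL
    have : Module.Finite S K :=
      Module.Finite.equiv (Submodule.quotientEquivOfIsCompl L K hL.symm)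
    exact Module.Finite.iff_fg.mp this
  have hB : iSupIndep fun p : ℕ × ℕ => (A (some p.1, p.2)).map K.mkQ :=
    (hA.map_mkQ hGA).comp (f := fun p : ℕ × ℕ => (some p.1, p.2)) fun p q h => by
      simpa [Prod.ext_iff] using h
  obtain ⟨K', hK', B', hB', hB'0, hB'N⟩ := Module.Injective.exists_isEssentialIn_top hM
    (Submodule.span_singleton_mkQ_eq_top h1 K) hB fun p h => by
      have h2 : A (some p.1, p.2) ≤ K := by
        rwa [← le_bot_iff, Submodule.map_le_iff_le_comap, Submodule.comap_bot,
          Submodule.ker_mkQ] at h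
      exact hA0 _ (le_bot_iff.mp ((le_inf le_rfl h2).trans (hA.inf_iSup_le hGA (some p.1, p.2))))
  exact IsSingularModule.false_of_iSupIndep
    (fun M _ _ hc hs => hS M hc hs.not_linearEquiv_self)
    (Submodule.span_singleton_mkQ_eq_top (Submodule.span_singleton_mkQ_eq_top h1 K) K')
    hK'.isSingularModule_quotient (hB'.comp (Nat.pairEquiv.injective)) (fun p => hB'0 _)
    (fun p => hB'N _)

theorem IsLeftPCIRing.isDomain (hS : IsLeftPCIRing S) (hni : ¬ Module.Injective S S) :
    IsDomain S := by
  have : Nontrivial S := by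
    by_contra h
    rw [not_nontrivial_iff_subsingleton] at h
    exact hni ⟨fun X Y _ _ _ _ f _ g => ⟨0, fun x => Subsingleton.elim _ _⟩⟩
  have : NoZeroDivisors S := ⟨fun {a b} hab => by
    by_contra! hcon
    obtain ⟨J, hJ⟩ := hS.exists_isCompl_ker_toSpanSingleton b
    set I := LinearMap.ker (LinearMap.toSpanSingleton S S b)
    have hI0 : I ≠ ⊥ := fun h => hcon.1 ((Submodule.eq_bot_iff I).mp h a hab)
    have hJ0 : J ≠ ⊥ := fun h => by
      rw [h] at hJ
      have : (1 : S) ∈ I := by rw [eq_top_of_isCompl_bot hJ]; trivial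
      exact hcon.2 (by simpa [I] using this)
    by_cases hI : Module.Injective S I
    · by_cases hJ' : Module.Injective S J
      · exact hni ((hI.prod hJ').of_linearEquiv (Submodule.prodEquivOfIsCompl I J hJ))
      · exact hS.false_of_isCompl_of_not_injective hJ.symm hI0 hJ'
    · exact hS.false_of_isCompl_of_not_injective hJ hJ0 hI⟩
  exact NoZeroDivisors.to_isDomain S

end PCI

/-- The right regular module, as the left regular module of the opposite ring. -/
def opSelfLinearEquiv (R : Type u) [Ring R] : R ≃ₗ[Rᵐᵒᵖ] Rᵐᵒᵖ where
  __ := MulOpposite.opAddEquiv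
  map_smul' _ _ := rfl

theorem mainTheorem7 (R : Type u) [Ring R] (hR : IsProperRightPCIRing R) : IsDomain R := by
  have hS : IsLeftPCIRing Rᵐᵒᵖ := fun M _ _ hM hne =>
    hR.1 M ⟨hM, fun ⟨e⟩ => hne ⟨e.trans (opSelfLinearEquiv R)⟩⟩
  have : IsDomain Rᵐᵒᵖ :=
    hS.isDomain fun h => hR.2 (h.of_linearEquiv (opSelfLinearEquiv R).symm)
  exact (RingEquiv.opOp R).toMulEquiv.isDomain Rᵐᵒᵖᵐᵒᵖ
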